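/- Let $R$ be a Prüfer domain (an integral domain in which every nonzero finitely generated ideal is invertible) with quotient field $K$, and suppose that $\operatorname{Spec}(R)$ is a Noetherian topological space. Let $\mathbf{F}(R)$ be the set of $R$-submodules of $K$. A semistar operation on $R$ is a map $\star:\mathbf{F}(R)\to\mathbf{F}(R)$, $I\mapsto I^\star$, such that for all $I,J\in\mathbf{F}(R)$ and $x\in K$: $I\subseteq I^\star=(I^\star)^\star$; if $I\subseteq J$ then $I^\star\subseteq J^\star$; and $(xI)^\star=x\cdot I^\star$. It is a (semi)star operation if $R^\star=R$, and it is stable if $(I\cap J)^\star=I^\star\cap J^\star$ for all $I,J\in\mathbf{F}(R)$. Semistar operations are ordered by $\star_1\le\star_2$ if and only if $I^{\star_1}\subseteq I^{\star_2}$ for all $I\in\mathbf{F}(R)$. For a ring $D$ with $R\subseteq D\subseteq K$ and a $D$-submodule $J$ of $K$ put $J^{v_D}:=(D:(D:J))$ if $J\neq 0$, where $(A:B):=\{x\in K\mid xB\subseteq A\}$, and $0^{v_D}:=0$. An ideal $I$ of $R$ is divisorial if $I^{v_R}=I$. For a stable semistar operation $\star$, the pseudo-spectrum $\operatorname{PsSpec}^\star(R)$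 is the set of all prime ideals $P$ of $R$ such that $P^\star\cap R=R$ and $L^\star\cap R=L$ for some $P$-primary ideal $L$ of $R$. Let $\mathcal{S}$ be the ordered set of stable (semi)star operations on $R$, and let $\mathcal{M}$ be the set of nondivisorial maximal ideals of $R$. Then: (a) For every $\star\in\mathcal{S}$ there are disjoint subsets $\Delta_1,\Delta_2\subseteq\operatorname{Max}(R)$ such that $\operatorname{Max}(R)=\Delta_1\cup\Delta_2$ and $$I^\star=\bigcap_{P\in\Delta_1}IR_P\ \cap\bigcap_{P\in\Delta_2}(IR_P)^{v_{R_P}}\qquad\text{for every } I\in\mathbf{F}(R).$$ (b) For every $\star\in\mathcal{S}$ one has $\operatorname{PsSpec}^\star(R)\subseteq\mathcal{M}$, and the map $\mathcal{S}\to\mathcal{P}(\mathcal{M})$, $\star\mapsto\operatorname{PsSpec}^\star(R)$, is an order isomorphism onto the power set of $\mathcal{M}$ ordered by inclusion. (c) $|\mathcal{S}|=2^{|\mathcal{M}|}$. -/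

import Mathlib

universe u v

open scoped Pointwise nonZeroDivisors

/-- An integral domain is *Prüfer* if every nonzero finitely generated ideal is invertible. -/
def IsPruferDomain (R : Type*) [CommRing R] [IsDomain R] : Prop :=
  ∀ I : Ideal R, I ≠ ⊥ → I.FG → IsUnit (I : FractionalIdeal R⁰ (FractionRing R))

/-- A *semistar operation* on a domain `R` with quotient field `K`: a closure operator
`I ↦ I^⋆` on the `R`-submodules of `K` such that `(x I)^⋆ = x I^⋆` for all `x ∈ K`
(including `x = 0`). -/
structure SemistarOperation (R K : Type*) [CommRing R] [Field K] [Algebra R K]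
    extends ClosureOperator (Submodule R K) where
  map_smul' : ∀ (x : K) (I : Submodule R K), toFun (x • I) = x • toFun I

namespace SemistarOperation

variable {R K : Type*} [CommRing R] [Field K] [Algebra R K]

instance : FunLike (SemistarOperation R K) (Submodule R K) (Submodule R K) where
  coe s := s.toClosureOperator
  coe_injective := by
    intro s t h
    have h' : s.toClosureOperator = t.toClosureOperator := DFunLike.coe_injective h
    cases s
    cases t
    cases h'
    rfl

/-- `⋆₁ ≤ ⋆₂` if and only if `I^⋆₁ ⊆ I^⋆₂` for every `I`. -/
instance : PartialOrder (SemistarOperation R K) :=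
  PartialOrder.lift (fun s => (s : Submodule R K → Submodule R K)) DFunLike.coe_injective

theorem le_iff (s t : SemistarOperation R K) : s ≤ t ↔ ∀ I, s I ≤ t I := Iff.rfl

/-- A semistar operation is *stable* if it distributes over finite intersections. -/
def IsStable (s : SemistarOperation R K) : Prop :=
  ∀ I J : Submodule R K, s (I ⊓ J) = s I ⊓ s J

/-- A semistar operation is a *(semi)star operation* if `R^⋆ = R`. -/
def IsStar (s : SemistarOperation R K) : Prop :=
  s (1 : Submodule R K) = 1

/-- The ideal `I^⋆ ∩ R` of `R`, for an ideal `I` of `R`. -/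
noncomputable def closureInRing (s : SemistarOperation R K) (I : Ideal R) : Ideal R :=
  (s (IsLocalization.coeSubmodule K I)).comap (Algebra.linearMap R K)

/-- The *pseudo-spectrum* of `⋆`: the primes `P` such that `P^⋆ ∩ R = R` and `L^⋆ ∩ R = L` for
some `P`-primary ideal `L`. -/
def pseudoSpectrum (s : SemistarOperation R K) : Set (PrimeSpectrum R) :=
  {P | s.closureInRing P.asIdeal = ⊤ ∧
    ∃ L : Ideal R, L.IsPrimary ∧ L.radical = P.asIdeal ∧ s.closureInRing L = L}

end SemistarOperation

/-- The ordered set of stable (semi)star operations on `R`, where `K` is the quotient field. -/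
abbrev StableStarOperation (R K : Type*) [CommRing R] [Field K] [Algebra R K] : Type _ :=
  {s : SemistarOperation R K // s.IsStable ∧ s.IsStar}

section Localization

variable {R : Type*} (K : Type*) [CommRing R] [IsDomain R] [Field K] [Algebra R K]
  [IsFractionRing R K]

/-- The localization `R_P`, as an `R`-submodule of the quotient field `K`. -/
noncomputable def localizationIn (P : PrimeSpectrum R) : Submodule R K :=
  Subalgebra.toSubmodule (Localization.subalgebra.ofField K P.asIdeal.primeCompl
    P.asIdeal.primeCompl_le_nonZeroDivisors)

variable {K} in
/-- The extension `I R_P` of an `R`-submodule `I` of `K`. -/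
noncomputable def extendAt (P : PrimeSpectrum R) (I : Submodule R K) : Submodule R K :=
  I * localizationIn K P

variable {K} in
theorem mem_localizationIn (P : PrimeSpectrum R) (x : K) :
    x ∈ localizationIn K P ↔
      ∃ a s : R, s ∉ P.asIdeal ∧ x = algebraMap R K a * (algebraMap R K s)⁻¹ := by
  change (∃ (a s : R) (_ : s ∈ P.asIdeal.primeCompl),
    x = algebraMap R K a * (algebraMap R K s)⁻¹) ↔ _
  simp only [exists_prop]
  rfl

end Localization

open Classical in
/-- The `v`-operation of an overring `D ⊆ K`: `J ↦ J^v = (D : (D : J))`, where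
`(A : B) = {x ∈ K | x B ⊆ A}`, with the usual convention `0^v = 0`. The convention is only
needed for `D = K`, see `vClosure_eq_div`. -/
noncomputable def vClosure {R K : Type*} [CommRing R] [Field K] [Algebra R K]
    (D J : Submodule R K) : Submodule R K :=
  if J = ⊥ then ⊥ else D / (D / J)

theorem vClosure_eq_div {R K : Type*} [CommRing R] [Field K] [Algebra R K]
    (D J : Submodule R K) (hD : D ≠ ⊤) : vClosure D J = D / (D / J) := by
  unfold vClosure
  split_ifs with h
  · subst h
    symm
    rw [eq_bot_iff]
    intro x hx
    by_contra hx0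
    have hx0 : x ≠ 0 := fun h => hx0 (by simp [h])
    apply hD
    rw [eq_top_iff]
    intro y _
    have h1 : x⁻¹ * y ∈ D / (⊥ : Submodule R K) := by
      intro z hz
      rw [Submodule.mem_bot] at hz
      simp [hz]
    have h2 := hx _ h1
    rwa [mul_inv_cancel_left₀ hx0] at h2
  · rfl

/-- An ideal `I` of `R` is *divisorial* if `I = I^v`, for the `v`-operation of `R`. -/
def IsDivisorial {R : Type*} (K : Type*) [CommRing R] [Field K] [Algebra R K]
    (I : Ideal R) : Prop :=
  vClosure 1 (IsLocalization.coeSubmodule K I) = IsLocalization.coeSubmodule K I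

/-- The set `Max(R)` of maximal ideals of `R`, inside the spectrum. -/
def maxSpec (R : Type*) [CommRing R] : Set (PrimeSpectrum R) :=
  {P | P.asIdeal.IsMaximal}

/-- The set of nondivisorial maximal ideals of `R`. -/
def nondivisorialMax (R K : Type*) [CommRing R] [Field K] [Algebra R K] :
    Set (PrimeSpectrum R) :=
  {P | P ∈ maxSpec R ∧ ¬ IsDivisorial K P.asIdeal}

/-! A stable operation is recovered from its localizing system F, the ideals `A` with `1 ∈ A^⋆`: `x
∈ I^⋆` iff `(I : x) ∈ F` (`IsStable.mem_apply_iff`). If `R^⋆ = R`, invertible ideals are closed, so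
the only finitely generated ideal in F is `R`. A Noetherian spectrum makes each maximal `M` the
radical of a finitely generated `J`. If `A ∈ F` and `a ∈ M` is not in `A R_M`, then `A R_M ⊆ a R_M`
because `R_M` is a valuation ring, so `A ⊆ J + (a) ⊆ M`, which is impossible. Hence `M R_M ⊆ A R_M`
for all `M` (`IsStar.exists_mul_mem`). It follows that `A` is a finite intersection of maximal
ideals, so F is determined by the maximal ideals in it; these are nondivisorial and form the
pseudo-spectrum.

Conversely, for nondivisorial `M` the ideal `M R_M` is not principal, hence idempotent, and the
v-operation of `R_M` is `I R_M ↦ (I R_M : M R_M)`. Idempotence makes this a closure, so every set of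
nondivisorial maximal ideals gives a stable operation (`ofSet`). -/

/-! ### Ideals in a ring with Noetherian spectrum -/

section Ring

variable {R : Type*} [CommRing R]

/-- Membership in an ideal can be checked at all maximal ideals. -/
theorem Ideal.mem_of_forall_isMaximal {A : Ideal R} {x : R}
    (h : ∀ N : Ideal R, N.IsMaximal → ∃ t ∉ N, t * x ∈ A) : x ∈ A := by
  by_contra hx
  have hne : (Submodule.comap (LinearMap.mulRight R x) A : Ideal R) ≠ ⊤ := by
    intro htop
    apply hx
    have h1 : (1 : R) ∈ (Submodule.comap (LinearMap.mulRight R x) A : Ideal R) := htop ▸ Submodule.mem_top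
    simpa using h1
  obtain ⟨N, hN, hle⟩ := Ideal.exists_le_maximal _ hne
  obtain ⟨t, htN, ht⟩ := h N hN
  exact htN (hle (by simpa using ht))

/-- The complement of `V(P)` is open, hence compact, and compact opens are complements of zero loci
of finitely generated ideals. -/
theorem exists_fg_radical_eq (hN : TopologicalSpace.NoetherianSpace (PrimeSpectrum R))
    (P : Ideal R) (hP : P.IsPrime) : ∃ J : Ideal R, J.FG ∧ J.radical = P := by
  obtain ⟨J, hJ, h⟩ := PrimeSpectrum.isCompact_isOpen_iff_ideal.1
    ⟨TopologicalSpace.NoetherianSpace.isCompact (PrimeSpectrum.zeroLocus (P : Set R))ᶜ,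
      (PrimeSpectrum.isClosed_zeroLocus (P : Set R)).isOpen_compl⟩
  refine ⟨J, hJ, ?_⟩
  rw [← PrimeSpectrum.vanishingIdeal_zeroLocus_eq_radical, compl_injective h,
    PrimeSpectrum.vanishingIdeal_zeroLocus_eq_radical, hP.radical]

/-- The hypothesis says `M R_M ⊆ A R_M`. It leaves only maximal ideals in `V(A)`, so each of the
finitely many irreducible closed sets covering `V(A)` carries one maximal ideal. The inclusion is
then checked locally. -/
theorem exists_finite_sInf_le (hN : TopologicalSpace.NoetherianSpace (PrimeSpectrum R))
    {A : Ideal R} (h : ∀ M : Ideal R, M.IsMaximal → A ≤ M → ∀ a ∈ M, ∃ t ∉ M, t * a ∈ A) :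
    ∃ T : Set (Ideal R), T.Finite ∧ (∀ M ∈ T, M.IsMaximal ∧ A ≤ M) ∧ sInf T ≤ A := by
  have hmax : ∀ Q : Ideal R, Q.IsPrime → A ≤ Q → Q.IsMaximal := by
    intro Q hQ hAQ
    obtain ⟨M, hM, hQM⟩ := Ideal.exists_le_maximal Q hQ.ne_top
    convert hM
    refine le_antisymm hQM fun a ha => ?_
    obtain ⟨t, ht, hta⟩ := h M hM (hAQ.trans hQM) a ha
    exact (hQ.mem_or_mem (hAQ hta)).resolve_left fun h' => ht (hQM h')
  obtain ⟨S, hS, hSc, hSi, hSU⟩ :=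
    TopologicalSpace.NoetherianSpace.exists_finite_set_isClosed_irreducible
      (PrimeSpectrum.isClosed_zeroLocus (A : Set R))
  have hT : ∀ M : Ideal R, M.IsMaximal → A ≤ M →
      M ∈ (fun s : Set (PrimeSpectrum R) => PrimeSpectrum.vanishingIdeal s) '' S := by
    intro M hM hAM
    have hmem : (⟨M, hM.isPrime⟩ : PrimeSpectrum R) ∈ PrimeSpectrum.zeroLocus (A : Set R) := hAM
    rw [hSU] at hmem
    obtain ⟨s, hs, hMs⟩ := hmem
    refine ⟨s, hs, ?_⟩
    have hprime : (PrimeSpectrum.vanishingIdeal s).IsPrime :=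
      PrimeSpectrum.isIrreducible_iff_vanishingIdeal_isPrime.1 (hSi s hs)
    have hle : A ≤ PrimeSpectrum.vanishingIdeal s := by
      rw [← PrimeSpectrum.subset_zeroLocus_iff_le_vanishingIdeal, hSU]
      exact Set.subset_sUnion_of_mem hs
    have hsM : PrimeSpectrum.vanishingIdeal s ≤ M := fun f hf =>
      (PrimeSpectrum.mem_vanishingIdeal _ _).1 hf _ hMs
    exact (hmax _ hprime hle).eq_of_le hM.ne_top hsM
  refine ⟨{M | M.IsMaximal ∧ A ≤ M}, (hS.image _).subset fun M hM => hT M hM.1 hM.2,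
    fun M hM => hM, fun x hx => Ideal.mem_of_forall_isMaximal fun N hN => ?_⟩
  by_cases hAN : A ≤ N
  · exact h N hN hAN x (Submodule.mem_sInf.1 hx N ⟨hN, hAN⟩)
  · obtain ⟨t, htA, htN⟩ := SetLike.not_le_iff_exists.1 hAN
    exact ⟨t, htN, A.mul_mem_right x htA⟩

/-- `M` is the only maximal ideal over `J`, so away from `M` the right side is locally everything;
at `M` the hypothesis is `X R_M ⊆ a R_M`. -/
theorem Ideal.le_sup_span_singleton_of_isMaximal {M J X : Ideal R} (hM : M.IsMaximal)
    (hJ : J.radical = M) {a : R} (h : ∀ x ∈ X, ∃ t ∉ M, t * x ∈ Ideal.span {a}) :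
    X ≤ J ⊔ Ideal.span {a} := by
  refine fun x hx => Ideal.mem_of_forall_isMaximal fun N hN => ?_
  by_cases hJN : J ≤ N
  · have hMN : M = N :=
      hM.eq_of_le hN.ne_top (hJ ▸ (hN.isPrime.radical_le_iff).2 hJN)
    subst hMN
    obtain ⟨t, ht, htx⟩ := h x hx
    exact ⟨t, ht, Ideal.mem_sup_right htx⟩
  · obtain ⟨t, htJ, htN⟩ := SetLike.not_le_iff_exists.1 hJN
    exact ⟨t, htN, Ideal.mem_sup_left (J.mul_mem_right x htJ)⟩

end Ring

/-! ### Prüfer domains: invertibility, valuations, nondivisorial maximal ideals -/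

namespace IsPruferDomain

variable {R : Type*} [CommRing R] [IsDomain R]

theorem exists_mul_eq_span_singleton (hR : IsPruferDomain R) {J : Ideal R} (hJ : J ≠ ⊥)
    (hfg : J.FG) : ∃ c : R, c ≠ 0 ∧ ∃ J' : Ideal R, J * J' = Ideal.span {c} := by
  obtain ⟨B, hB⟩ := (hR J hJ hfg).exists_right_inv
  obtain ⟨c, J', hc, rfl⟩ := FractionalIdeal.exists_eq_spanSingleton_mul B
  refine ⟨c, hc, J', ?_⟩
  have hc' : algebraMap R (FractionRing R) c ≠ 0 :=
    (map_ne_zero_iff _ (IsFractionRing.injective R (FractionRing R))).2 hc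
  rw [← FractionalIdeal.coeIdeal_inj (K := FractionRing R), FractionalIdeal.coeIdeal_mul,
    FractionalIdeal.coeIdeal_span_singleton,
    ← mul_one (FractionalIdeal.spanSingleton _ (algebraMap R (FractionRing R) c)), ← hB,
    mul_left_comm, ← mul_assoc (FractionalIdeal.spanSingleton _ _),
    FractionalIdeal.spanSingleton_mul_spanSingleton, mul_inv_cancel₀ hc',
    FractionalIdeal.spanSingleton_one, one_mul]

/-- The localizations of a Prüfer domain at prime ideals are valuation rings. -/
theorem exists_mul_eq_mul (hR : IsPruferDomain R) {P : Ideal R} (hP : P.IsPrime) (a b : R) :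
    ∃ t ∉ P, ∃ r : R, t * a = r * b ∨ t * b = r * a := by
  by_cases h0 : Ideal.span {a, b} = ⊥
  · have ha : a = 0 := by
      have : a ∈ Ideal.span {a, b} := Ideal.subset_span (by simp)
      simpa [h0] using this
    exact ⟨1, hP.one_notMem, 0, Or.inl (by simp [ha])⟩
  obtain ⟨c, hc, J', hJ'⟩ := hR.exists_mul_eq_span_singleton h0 (Submodule.fg_span (by simp))
  have hdvd : ∀ x ∈ Ideal.span {a, b}, ∀ y ∈ J', ∃ z, x * y = c * z := fun x hx y hy => by
    have := Ideal.mul_mem_mul hx hy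
    rw [hJ', Ideal.mem_span_singleton] at this
    exact this
  have hcm : c ∈ Ideal.span {a, b} * J' := hJ' ▸ Ideal.mem_span_singleton_self c
  rw [Ideal.span_insert, Ideal.sup_mul, Submodule.mem_sup] at hcm
  obtain ⟨y, hy, z, hz, hyz⟩ := hcm
  obtain ⟨p, hp, rfl⟩ := Ideal.mem_span_singleton_mul.1 hy
  obtain ⟨q, hq, rfl⟩ := Ideal.mem_span_singleton_mul.1 hz
  have ha : a ∈ Ideal.span {a, b} := Ideal.subset_span (by simp)
  have hb : b ∈ Ideal.span {a, b} := Ideal.subset_span (by simp)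
  obtain ⟨α, hα⟩ := hdvd a ha p hp
  obtain ⟨β, hβ⟩ := hdvd b hb q hq
  obtain ⟨γ, hγ⟩ := hdvd b hb p hp
  obtain ⟨δ, hδ⟩ := hdvd a ha q hq
  -- Here `α = ap/c` and `β = bq/c`, where `c = ap + bq`; one of them is a unit in `R_P`.
  have hsum : α + β = 1 := mul_left_cancel₀ hc (by rw [mul_add, ← hα, ← hβ, hyz, mul_one])
  by_cases hαP : α ∈ P
  · have hβP : β ∉ P := fun h => hP.one_notMem (hsum ▸ P.add_mem hαP h)
    exact ⟨β, hβP, δ, Or.inl (mul_left_cancel₀ hc (by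
      rw [← mul_assoc, ← hβ, ← mul_assoc, ← hδ]; ring))⟩
  · exact ⟨α, hαP, γ, Or.inr (mul_left_cancel₀ hc (by
      rw [← mul_assoc, ← hα, ← mul_assoc, ← hγ]; ring))⟩

variable {K : Type*} [Field K] [Algebra R K] [IsFractionRing R K]

theorem exists_smul_mem_one (hR : IsPruferDomain R) {P : Ideal R} (hP : P.IsPrime) {x : K}
    (hx : x ≠ 0) : ∃ t ∉ P, t • x ∈ (1 : Submodule R K) ∨ t • x⁻¹ ∈ (1 : Submodule R K) := by
  obtain ⟨a, b, hb, rfl⟩ := IsFractionRing.div_surjective (A := R) x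
  have hb' : algebraMap R K b ≠ 0 := IsFractionRing.to_map_ne_zero_of_mem_nonZeroDivisors hb
  have ha' : algebraMap R K a ≠ 0 := fun h => hx (by simp [h])
  obtain ⟨t, ht, r, h | h⟩ := hR.exists_mul_eq_mul hP a b
  · refine ⟨t, ht, Or.inl (Submodule.mem_one.2 ⟨r, ?_⟩)⟩
    rw [Algebra.smul_def, ← mul_div_assoc, ← map_mul, h, map_mul, mul_div_cancel_right₀ _ hb']
  · refine ⟨t, ht, Or.inr (Submodule.mem_one.2 ⟨r, ?_⟩)⟩
    rw [Algebra.smul_def, inv_div, ← mul_div_assoc, ← map_mul, h, map_mul,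
      mul_div_cancel_right₀ _ ha']

/-- A finitely generated ideal `J ≠ 0` is recovered from its colon submodule `(R : J)`. -/
theorem mem_coeSubmodule_of_forall_mul_mem (hR : IsPruferDomain R) {J : Ideal R} (hJ : J ≠ ⊥)
    (hfg : J.FG) {x : K}
    (hx : ∀ y ∈ (1 : Submodule R K) / IsLocalization.coeSubmodule K J,
      y * x ∈ (1 : Submodule R K)) : x ∈ IsLocalization.coeSubmodule K J := by
  obtain ⟨c, hc, J', hJ'⟩ := hR.exists_mul_eq_span_singleton hJ hfg
  have hc' : algebraMap R K c ≠ 0 :=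
    (map_ne_zero_iff _ (IsFractionRing.injective R K)).2 hc
  -- Since `c ∈ J J'`, writing `x = c (x/c)` reduces the claim to products `j j'`, for which `j'/c`
  -- lies in `(R : J)`.
  have key : ∀ d ∈ J * J', algebraMap R K d * ((algebraMap R K c)⁻¹ * x) ∈
      IsLocalization.coeSubmodule K J := by
    intro d hd
    induction hd using Submodule.mul_induction_on' with
    | mem_mul_mem j hj j' hj' =>
      have h1 : (algebraMap R K c)⁻¹ * algebraMap R K j' ∈
          (1 : Submodule R K) / IsLocalization.coeSubmodule K J := by
        rw [Submodule.mem_div_iff_forall_mul_mem]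
        rintro _ ⟨i, hi, rfl⟩
        have h2 : i * j' ∈ Ideal.span {c} := hJ' ▸ Ideal.mul_mem_mul hi hj'
        obtain ⟨z, hz⟩ := Ideal.mem_span_singleton.1 h2
        refine Submodule.mem_one.2 ⟨z, ?_⟩
        rw [Algebra.linearMap_apply, mul_assoc, ← map_mul, mul_comm j', hz, map_mul,
          inv_mul_cancel_left₀ hc']
      obtain ⟨z, hz⟩ := Submodule.mem_one.1 (hx _ h1)
      refine (IsLocalization.mem_coeSubmodule K J).2 ⟨j * z, J.mul_mem_right z hj, ?_⟩
      rw [map_mul, hz, map_mul]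
      ring
    | add d _ e _ hd he =>
      rw [map_add, add_mul]
      exact add_mem hd he
  have h := key c (hJ' ▸ Ideal.mem_span_singleton_self c)
  rwa [mul_inv_cancel_left₀ hc'] at h

theorem isDivisorial_of_fg (hR : IsPruferDomain R) {J : Ideal R} (hfg : J.FG) :
    IsDivisorial K J := by
  unfold IsDivisorial vClosure
  split_ifs with h
  · exact h.symm
  have hJ : J ≠ ⊥ := by rintro rfl; exact h (IsLocalization.coeSubmodule_bot K)
  apply le_antisymm
  · intro x hx
    exact hR.mem_coeSubmodule_of_forall_mul_mem hJ hfg fun y hy => by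
      rw [mul_comm]; exact Submodule.mem_div_iff_forall_mul_mem.1 hx y hy
  · intro x hx
    rw [Submodule.mem_div_iff_forall_mul_mem]
    intro y hy
    rw [mul_comm]
    exact Submodule.mem_div_iff_forall_mul_mem.1 hy x hx

/-- The maximal ideal of the localization at a nondivisorial maximal ideal is not principal. -/
theorem exists_mem_forall_mul_notMem_span (hR : IsPruferDomain R)
    (hN : TopologicalSpace.NoetherianSpace (PrimeSpectrum R)) {M : Ideal R} (hM : M.IsMaximal)
    (hdiv : ¬ IsDivisorial K M) {c : R} (hc : c ∈ M) :
    ∃ a ∈ M, ∀ t ∉ M, t * a ∉ Ideal.span {c} := by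
  by_contra! hcon
  obtain ⟨J, hJ, hJM⟩ := exists_fg_radical_eq hN M hM.isPrime
  refine hdiv (hR.isDivisorial_of_fg ?_)
  -- If `M R_M = c R_M`, then `M` is finitely generated and therefore divisorial.
  have h : M = J ⊔ Ideal.span {c} := le_antisymm
    (Ideal.le_sup_span_singleton_of_isMaximal hM hJM hcon)
    (sup_le (hJM ▸ Ideal.le_radical) ((Ideal.span_singleton_le_iff_mem _).2 hc))
  rw [h]
  exact Submodule.FG.sup hJ (Submodule.fg_span_singleton c)

/-- The maximal ideal of the localization at a nondivisorial maximal ideal is idempotent. -/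
theorem exists_mul_eq_mul_of_not_isDivisorial (hR : IsPruferDomain R)
    (hN : TopologicalSpace.NoetherianSpace (PrimeSpectrum R)) {M : Ideal R} (hM : M.IsMaximal)
    (hdiv : ¬ IsDivisorial K M) {c : R} (hc : c ∈ M) :
    ∃ a ∈ M, ∃ b ∈ M, ∃ t ∉ M, t * c = a * b := by
  obtain ⟨a, ha, h⟩ := hR.exists_mem_forall_mul_notMem_span hN hM hdiv hc
  -- As `a ∉ c R_M`, comparability gives `c = (r/t) a`, and `r` cannot be a unit in `R_M`.
  obtain ⟨t, ht, r, hr | hr⟩ := hR.exists_mul_eq_mul hM.isPrime a c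
  · exact absurd (hr ▸ Ideal.mul_mem_left _ r (Ideal.mem_span_singleton_self c)) (h t ht)
  · refine ⟨a, ha, r, ?_, t, ht, by rw [hr, mul_comm]⟩
    by_contra hrM
    exact h r hrM (hr ▸ Ideal.mul_mem_left _ t (Ideal.mem_span_singleton_self c))

/-- The value `z` lies in `R_M` as soon as `z M ⊆ R_M`, for `M` nondivisorial. -/
theorem exists_smul_mem_one_of_forall (hR : IsPruferDomain R)
    (hN : TopologicalSpace.NoetherianSpace (PrimeSpectrum R)) {M : Ideal R} (hM : M.IsMaximal)
    (hdiv : ¬ IsDivisorial K M) {z : K}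
    (hz : ∀ a ∈ M, ∃ t ∉ M, (t * a) • z ∈ (1 : Submodule R K)) :
    ∃ t ∉ M, t • z ∈ (1 : Submodule R K) := by
  by_cases h0 : z = 0
  · exact ⟨1, hM.isPrime.one_notMem, by simp [h0]⟩
  obtain ⟨t, ht, h | h⟩ := hR.exists_smul_mem_one hM.isPrime h0
  · exact ⟨t, ht, h⟩
  obtain ⟨c, hc⟩ := Submodule.mem_one.1 h
  have htz : algebraMap R K t = algebraMap R K c * z := by
    rw [hc, Algebra.smul_def, mul_assoc, inv_mul_cancel₀ h0, mul_one]
  by_cases hcM : c ∈ M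
  -- Now `z⁻¹ = c/t` lies in `M R_M`, so `z M ⊆ R_M` would give `M R_M = c R_M`.
  · exfalso
    obtain ⟨a, ha, hac⟩ := hR.exists_mem_forall_mul_notMem_span hN hM hdiv hcM
    obtain ⟨u, hu, huz⟩ := hz a ha
    obtain ⟨r, hr⟩ := Submodule.mem_one.1 huz
    refine hac (t * u) (fun h' => (hM.isPrime.mem_or_mem h').elim ht hu)
      (Ideal.mem_span_singleton.2 ⟨r, IsFractionRing.injective R K ?_⟩)
    rw [map_mul _ c, hr, Algebra.smul_def, map_mul, map_mul, map_mul, htz]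
    ring
  · exact ⟨c, hcM, Submodule.mem_one.2 ⟨t, by rw [htz, Algebra.smul_def]⟩⟩

end IsPruferDomain

theorem not_isDivisorial_ne_bot {R K : Type*} [CommRing R] [Field K] [Algebra R K] {P : Ideal R}
    (h : ¬ IsDivisorial K P) : P ≠ ⊥ := by
  rintro rfl
  apply h
  rw [IsDivisorial, IsLocalization.coeSubmodule_bot, vClosure, if_pos rfl]

/-! ### Elementwise description of `I R_P` and its v-closure -/

section Localization

variable {R K : Type*} [CommRing R] [IsDomain R] [Field K] [Algebra R K] [IsFractionRing R K]

theorem mem_localizationIn_iff_smul {P : PrimeSpectrum R} {x : K} :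
    x ∈ localizationIn K P ↔ ∃ t ∉ P.asIdeal, t • x ∈ (1 : Submodule R K) := by
  rw [mem_localizationIn]
  constructor
  · rintro ⟨a, t, ht, rfl⟩
    have ht' : algebraMap R K t ≠ 0 := (map_ne_zero_iff _ (IsFractionRing.injective R K)).2
      fun h => ht (h ▸ P.asIdeal.zero_mem)
    refine ⟨t, ht, Submodule.mem_one.2 ⟨a, ?_⟩⟩
    rw [Algebra.smul_def, mul_left_comm, mul_inv_cancel₀ ht', mul_one]
  · rintro ⟨t, ht, h⟩
    have ht' : algebraMap R K t ≠ 0 := (map_ne_zero_iff _ (IsFractionRing.injective R K)).2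
      fun h => ht (h ▸ P.asIdeal.zero_mem)
    obtain ⟨a, ha⟩ := Submodule.mem_one.1 h
    exact ⟨a, t, ht, by rw [ha, Algebra.smul_def, mul_comm, inv_mul_cancel_left₀ ht']⟩

theorem mem_extendAt_iff_smul {P : PrimeSpectrum R} {I : Submodule R K} {x : K} :
    x ∈ extendAt P I ↔ ∃ t ∉ P.asIdeal, t • x ∈ I := by
  constructor
  · intro hx
    induction hx using Submodule.mul_induction_on' with
    | mem_mul_mem m hm n hn =>
      obtain ⟨t, ht, h⟩ := mem_localizationIn_iff_smul.1 hn
      obtain ⟨a, ha⟩ := Submodule.mem_one.1 h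
      refine ⟨t, ht, ?_⟩
      rw [← mul_smul_comm, ← ha, mul_comm, ← Algebra.smul_def]
      exact I.smul_mem a hm
    | add x _ y _ hx hy =>
      obtain ⟨t, ht, hx⟩ := hx
      obtain ⟨u, hu, hy⟩ := hy
      refine ⟨t * u, fun h => (P.isPrime.mem_or_mem h).elim ht hu, ?_⟩
      rw [smul_add]
      refine I.add_mem ?_ ?_
      · rw [mul_comm, mul_smul]
        exact I.smul_mem u hx
      · rw [mul_smul]
        exact I.smul_mem t hy
  · rintro ⟨t, ht, h⟩
    have ht' : algebraMap R K t ≠ 0 := (map_ne_zero_iff _ (IsFractionRing.injective R K)).2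
      fun h => ht (h ▸ P.asIdeal.zero_mem)
    have h1 : (algebraMap R K t)⁻¹ ∈ localizationIn K P :=
      (mem_localizationIn P _).2 ⟨1, t, ht, by simp⟩
    have h2 := Submodule.mul_mem_mul h h1
    rwa [Algebra.smul_def, mul_comm (algebraMap R K t), mul_inv_cancel_right₀ ht'] at h2

theorem extendAt_eq_bot_iff {P : PrimeSpectrum R} {I : Submodule R K} :
    extendAt P I = ⊥ ↔ I = ⊥ := by
  refine ⟨fun h => ?_, fun h => by rw [h, extendAt, Submodule.bot_mul]⟩
  rw [eq_bot_iff, ← h]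
  exact fun x hx => mem_extendAt_iff_smul.2 ⟨1, P.isPrime.one_notMem, by rwa [one_smul]⟩

/-- The point is that `(I R_P)^v = (I R_P : P R_P)`. For `⊇`, if `y ∈ (R_P : I R_P)` then `xy P ⊆
R_P`, which forces `xy ∈ R_P` because `P` is nondivisorial. -/
theorem mem_vClosure_extendAt_iff (hR : IsPruferDomain R)
    (hN : TopologicalSpace.NoetherianSpace (PrimeSpectrum R)) {P : PrimeSpectrum R}
    (hP : P ∈ nondivisorialMax R K) {I : Submodule R K} {x : K} :
    x ∈ vClosure (localizationIn K P) (extendAt P I) ↔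
      ∀ a ∈ P.asIdeal, ∃ t ∉ P.asIdeal, (t * a) • x ∈ I := by
  have hM : P.asIdeal.IsMaximal := hP.1
  by_cases hI : I = ⊥
  · subst hI
    rw [vClosure, if_pos (extendAt_eq_bot_iff.2 rfl)]
    obtain ⟨a, ha, ha0⟩ := Submodule.exists_mem_ne_zero_of_ne_bot (not_isDivisorial_ne_bot hP.2)
    constructor
    · intro h a _
      exact ⟨1, P.isPrime.one_notMem, by rw [(Submodule.mem_bot R).1 h]; simp⟩
    · intro h
      obtain ⟨t, ht, h⟩ := h a ha
      rw [Submodule.mem_bot, Algebra.smul_def, mul_eq_zero,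
        map_eq_zero_iff _ (IsFractionRing.injective R K), mul_eq_zero] at h
      rcases h with (h | h) | h
      · exact absurd (h ▸ P.asIdeal.zero_mem) ht
      · exact absurd h ha0
      · exact h
  rw [vClosure, if_neg (extendAt_eq_bot_iff.not.2 hI), Submodule.mem_div_iff_forall_mul_mem]
  constructor
  · intro h p hp
    by_contra! hcon
    have hpx : p • x ≠ 0 := fun h0 => hcon 1 P.isPrime.one_notMem (by rw [one_mul, h0]; simp)
    have hp0 : algebraMap R K p ≠ 0 := fun h0 => hpx (by rw [Algebra.smul_def, h0, zero_mul])
    have hx0 : x ≠ 0 := fun h0 => hpx (by rw [h0, smul_zero])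
    -- If `px ∉ I R_P`, comparability gives `I R_P ⊆ px R_P`. Pairing `x` with `(px)⁻¹` then puts
    -- `1/p` in `R_P`, although `p ∈ P`.
    have hinv : (p • x)⁻¹ ∈ localizationIn K P / extendAt P I := by
      rw [Submodule.mem_div_iff_forall_mul_mem]
      intro y hy
      by_cases hy0 : y = 0
      · simp [hy0]
      obtain ⟨u, hu, huy⟩ := mem_extendAt_iff_smul.1 hy
      obtain ⟨t, ht, h1 | h1⟩ := hR.exists_smul_mem_one hM.isPrime
        (mul_ne_zero (inv_ne_zero hpx) hy0)
      · exact mem_localizationIn_iff_smul.2 ⟨t, ht, h1⟩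
      · exfalso
        obtain ⟨r, hr⟩ := Submodule.mem_one.1 h1
        refine hcon (u * t) (fun h => (P.isPrime.mem_or_mem h).elim hu ht) ?_
        have : (u * t * p) • x = r • u • y := by
          have h2 : t • p • x = r • y := by
            rw [Algebra.smul_def r, hr, mul_inv, inv_inv, smul_mul_assoc, mul_assoc,
              inv_mul_cancel₀ hy0, mul_one]
          rw [mul_smul, mul_smul, h2, smul_comm]
        rw [this]
        exact I.smul_mem r huy
    obtain ⟨t, ht, h1⟩ := mem_localizationIn_iff_smul.1 (h _ hinv)
    obtain ⟨r, hr⟩ := Submodule.mem_one.1 h1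
    have h2 : t = r * p := by
      apply IsFractionRing.injective R K
      rw [map_mul, hr, Algebra.smul_def, Algebra.smul_def, mul_inv]
      field_simp
    exact ht (h2 ▸ P.asIdeal.mul_mem_left r hp)
  · intro h y hy
    rw [Submodule.mem_div_iff_forall_mul_mem] at hy
    refine mem_localizationIn_iff_smul.2
      (hR.exists_smul_mem_one_of_forall hN hM hP.2 fun a ha => ?_)
    obtain ⟨t, ht, htx⟩ := h a ha
    have h1 := hy _ (mem_extendAt_iff_smul.2 ⟨1, P.isPrime.one_notMem, by rwa [one_smul]⟩)
    obtain ⟨u, hu, h2⟩ := mem_localizationIn_iff_smul.1 h1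
    refine ⟨u * t, fun h => (P.isPrime.mem_or_mem h).elim hu ht, ?_⟩
    rwa [mul_assoc, mul_smul, mul_comm x, ← mul_smul_comm]

end Localization

/-! ### The localizing system of a stable operation -/

namespace SemistarOperation

variable {R K : Type*} [CommRing R] [Field K] [Algebra R K]

theorem le_apply (s : SemistarOperation R K) (I : Submodule R K) : I ≤ s I :=
  s.toClosureOperator.le_closure I

theorem apply_mono (s : SemistarOperation R K) {I J : Submodule R K} (h : I ≤ J) : s I ≤ s J :=
  s.toClosureOperator.monotone h

theorem apply_smul (s : SemistarOperation R K) (x : K) (I : Submodule R K) :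
    s (x • I) = x • s I :=
  s.map_smul' x I

theorem apply_bot (s : SemistarOperation R K) : s ⊥ = ⊥ := by
  have h := s.apply_smul 0 ⊥
  have h0 : ∀ I : Submodule R K, (0 : K) • I = ⊥ := fun I => by
    rw [eq_bot_iff]
    intro x hx
    obtain ⟨y, -, rfl⟩ := (Submodule.mem_smul_pointwise_iff_exists _ _ _).1 hx
    simp
  rwa [h0, h0] at h

theorem mem_apply_smul_iff (s : SemistarOperation R K) {x y : K} (hx : x ≠ 0)
    {I : Submodule R K} : x * y ∈ s (x • I) ↔ y ∈ s I := by
  rw [s.apply_smul, Submodule.mem_smul_pointwise_iff_exists]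
  constructor
  · rintro ⟨z, hz, h⟩
    rwa [← mul_left_cancel₀ hx h]
  · exact fun h => ⟨y, h, rfl⟩

/-- The ideals `A` of `R` with `A^⋆ ∩ R = R`. -/
def localizingSystem (s : SemistarOperation R K) : Set (Ideal R) :=
  {A | (1 : K) ∈ s (IsLocalization.coeSubmodule K A)}

theorem closureInRing_eq_top_iff (s : SemistarOperation R K) (A : Ideal R) :
    s.closureInRing A = ⊤ ↔ A ∈ s.localizingSystem := by
  rw [Ideal.eq_top_iff_one, closureInRing, Submodule.mem_comap, Algebra.linearMap_apply, map_one]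
  rfl

theorem localizingSystem_mono (s : SemistarOperation R K) {A B : Ideal R} (h : A ≤ B)
    (hA : A ∈ s.localizingSystem) : B ∈ s.localizingSystem :=
  s.apply_mono (Submodule.map_mono h) hA

theorem top_mem_localizingSystem (s : SemistarOperation R K) : ⊤ ∈ s.localizingSystem := by
  apply s.le_apply
  rw [IsLocalization.coeSubmodule_top]
  exact (Submodule.mem_one.2 ⟨1, map_one _⟩)

/-- The ideal `(I : x)` of all `r : R` with `r x ∈ I`. -/
def colonIdeal (I : Submodule R K) (x : K) : Ideal R :=
  I.comap (LinearMap.toSpanSingleton R K x)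

theorem mem_colonIdeal {I : Submodule R K} {x : K} {r : R} : r ∈ colonIdeal I x ↔ r • x ∈ I :=
  Iff.rfl

/-- For `x ≠ 0`, `(I : x)` is `x⁻¹ I ∩ R` inside `K`; stability splits its closure, and `1 ∈ (x⁻¹
I)^⋆` iff `x ∈ I^⋆`. -/
theorem IsStable.mem_apply_iff {s : SemistarOperation R K} (hs : s.IsStable)
    {I : Submodule R K} {x : K} : x ∈ s I ↔ colonIdeal I x ∈ s.localizingSystem := by
  by_cases hx : x = 0
  · subst hx
    have : colonIdeal I (0 : K) = ⊤ := by
      rw [Ideal.eq_top_iff_one, mem_colonIdeal, smul_zero]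
      exact I.zero_mem
    rw [this]
    exact iff_of_true (Submodule.zero_mem _) s.top_mem_localizingSystem
  have h : IsLocalization.coeSubmodule K (colonIdeal I x) = x⁻¹ • I ⊓ 1 := by
    ext y
    rw [IsLocalization.mem_coeSubmodule, Submodule.mem_inf,
      Submodule.mem_smul_pointwise_iff_exists, Submodule.mem_one]
    constructor
    · rintro ⟨r, hr, rfl⟩
      refine ⟨⟨r • x, hr, ?_⟩, r, rfl⟩
      rw [smul_eq_mul, Algebra.smul_def, mul_comm, mul_inv_cancel_right₀ hx]
    · rintro ⟨⟨z, hz, h⟩, r, rfl⟩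
      refine ⟨r, ?_, rfl⟩
      rw [mem_colonIdeal, Algebra.smul_def, ← h, smul_eq_mul, mul_comm, mul_inv_cancel_left₀ hx]
      exact hz
  change _ ↔ (1 : K) ∈ s _
  rw [h, hs, Submodule.mem_inf, ← s.mem_apply_smul_iff (inv_ne_zero hx), inv_mul_cancel₀ hx]
  exact (and_iff_left (s.le_apply _ (Submodule.mem_one.2 ⟨1, map_one _⟩))).symm

variable [IsFractionRing R K]

theorem IsStable.inf_mem {s : SemistarOperation R K} (hs : s.IsStable) {A B : Ideal R}
    (hA : A ∈ s.localizingSystem) (hB : B ∈ s.localizingSystem) :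
    A ⊓ B ∈ s.localizingSystem := by
  have h : IsLocalization.coeSubmodule K (A ⊓ B) =
      IsLocalization.coeSubmodule K A ⊓ IsLocalization.coeSubmodule K B :=
    Submodule.map_inf _ (IsFractionRing.injective R K)
  change (1 : K) ∈ s _
  rw [h, hs]
  exact ⟨hA, hB⟩

theorem IsStable.sInf_mem {s : SemistarOperation R K} (hs : s.IsStable) {T : Set (Ideal R)}
    (hT : T.Finite) (h : T ⊆ s.localizingSystem) : sInf T ∈ s.localizingSystem := by
  induction T, hT using Set.Finite.induction_on with
  | empty => rw [sInf_empty]; exact s.top_mem_localizingSystem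
  | insert _ _ ih =>
    rw [sInf_insert]
    exact hs.inf_mem (h (Set.mem_insert _ _)) (ih ((Set.subset_insert _ _).trans h))

/-! ### Stable (semi)star operations over a Prüfer domain -/

variable [IsDomain R]

/-- If `yJ ⊆ R`, then `y J^⋆ ⊆ R^⋆ = R`; thus `J^⋆` is bounded by `(R : (R : J))`, which is `J` by
invertibility. -/
theorem IsStar.apply_coeSubmodule_of_fg {s : SemistarOperation R K} (hs : s.IsStar)
    (hR : IsPruferDomain R) {J : Ideal R} (hJ : J.FG) :
    s (IsLocalization.coeSubmodule K J) = IsLocalization.coeSubmodule K J := by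
  by_cases h0 : J = ⊥
  · rw [h0, IsLocalization.coeSubmodule_bot, s.apply_bot]
  refine le_antisymm (fun x hx => ?_) (s.le_apply _)
  refine hR.mem_coeSubmodule_of_forall_mul_mem h0 hJ fun y hy => ?_
  by_cases hy0 : y = 0
  · rw [hy0, zero_mul]
    exact Submodule.zero_mem _
  have hle : y • IsLocalization.coeSubmodule K J ≤ 1 := by
    intro z hz
    obtain ⟨w, hw, rfl⟩ := (Submodule.mem_smul_pointwise_iff_exists _ _ _).1 hz
    exact Submodule.mem_div_iff_forall_mul_mem.1 hy w hw
  have h := s.apply_mono hle ((s.mem_apply_smul_iff hy0).2 hx)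
  rwa [show s 1 = 1 from hs] at h

theorem IsStar.eq_top_of_fg {s : SemistarOperation R K} (hs : s.IsStar)
    (hR : IsPruferDomain R) {J : Ideal R} (hJ : J.FG) (h : J ∈ s.localizingSystem) : J = ⊤ := by
  have h1 : (1 : K) ∈ s (IsLocalization.coeSubmodule K J) := h
  rw [hs.apply_coeSubmodule_of_fg hR hJ, IsLocalization.mem_coeSubmodule] at h1
  obtain ⟨r, hr, h1⟩ := h1
  rw [Ideal.eq_top_iff_one, ← IsFractionRing.injective R K (h1.trans (map_one _).symm)]
  exact hr

/-- An ideal `A` with `A^⋆ ∩ R = R` generates at least the maximal ideal in `R_M`. -/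
theorem IsStar.exists_mul_mem {s : SemistarOperation R K} (hs : s.IsStar)
    (hR : IsPruferDomain R) (hN : TopologicalSpace.NoetherianSpace (PrimeSpectrum R))
    {A M : Ideal R} (hA : A ∈ s.localizingSystem) (hM : M.IsMaximal) {a : R}
    (ha : a ∈ M) : ∃ t ∉ M, t * a ∈ A := by
  by_contra! hcon
  obtain ⟨J, hJ, hJM⟩ := exists_fg_radical_eq hN M hM.isPrime
  -- If `a ∉ A R_M`, then `A R_M ⊆ a R_M`, so a proper finitely generated ideal would lie in the
  -- localizing system.
  have hle : A ≤ J ⊔ Ideal.span {a} := by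
    refine Ideal.le_sup_span_singleton_of_isMaximal hM hJM fun x hx => ?_
    obtain ⟨t, ht, r, h | h⟩ := hR.exists_mul_eq_mul hM.isPrime x a
    · exact ⟨t, ht, h ▸ Ideal.mul_mem_left _ r (Ideal.mem_span_singleton_self a)⟩
    · exact absurd (h ▸ A.mul_mem_left r hx) (hcon t ht)
  have htop := hs.eq_top_of_fg hR (Submodule.FG.sup hJ (Submodule.fg_span_singleton a))
    (s.localizingSystem_mono hle hA)
  refine hM.ne_top (top_le_iff.1 (htop ▸ sup_le ?_ ?_))
  · exact hJM ▸ Ideal.le_radical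
  · exact (Ideal.span_singleton_le_iff_mem _).2 ha

/-- For a maximal `M ⊇ P`, `M R_M ⊆ P R_M` forces `P = M`. Moreover `P^⋆ ⊆ P^v`, so `P^v = P` would
put `1` in `P`. -/
theorem IsStar.mem_nondivisorialMax {s : SemistarOperation R K} (hs : s.IsStar)
    (hR : IsPruferDomain R) (hN : TopologicalSpace.NoetherianSpace (PrimeSpectrum R))
    {P : PrimeSpectrum R} (hP : P.asIdeal ∈ s.localizingSystem) : P ∈ nondivisorialMax R K := by
  have h1 : (1 : K) ∈ s (IsLocalization.coeSubmodule K P.asIdeal) := hP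
  constructor
  · obtain ⟨M, hM, hPM⟩ := Ideal.exists_le_maximal _ P.isPrime.ne_top
    change P.asIdeal.IsMaximal
    convert hM
    refine le_antisymm hPM fun a ha => ?_
    obtain ⟨t, ht, hta⟩ := hs.exists_mul_mem hR hN hP hM ha
    exact (P.isPrime.mem_or_mem hta).resolve_left fun h => ht (hPM h)
  · intro hdiv
    rw [IsDivisorial, vClosure] at hdiv
    split_ifs at hdiv with h0
    · rw [h0, s.apply_bot, Submodule.mem_bot] at h1
      exact one_ne_zero h1
    have h2 : (1 : K) ∈ IsLocalization.coeSubmodule K P.asIdeal := by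
      rw [← hdiv, Submodule.mem_div_iff_forall_mul_mem]
      intro y hy
      rw [mul_comm]
      by_cases hy0 : y = 0
      · rw [hy0, zero_mul]
        exact Submodule.zero_mem _
      have hle : y • IsLocalization.coeSubmodule K P.asIdeal ≤ 1 := by
        intro z hz
        obtain ⟨w, hw, rfl⟩ := (Submodule.mem_smul_pointwise_iff_exists _ _ _).1 hz
        exact Submodule.mem_div_iff_forall_mul_mem.1 hy w hw
      have h := s.apply_mono hle ((s.mem_apply_smul_iff hy0).2 h1)
      rwa [show s 1 = 1 from hs] at h
    obtain ⟨r, hr, h2⟩ := (IsLocalization.mem_coeSubmodule K _).1 h2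
    rw [← map_one (algebraMap R K)] at h2
    exact P.isPrime.one_notMem (IsFractionRing.injective R K h2 ▸ hr)

/-- A stable (semi)star operation is determined by the maximal ideals in its localizing system. -/
theorem IsStar.mem_apply_iff {s : SemistarOperation R K} (hs : s.IsStar) (hst : s.IsStable)
    (hR : IsPruferDomain R) (hN : TopologicalSpace.NoetherianSpace (PrimeSpectrum R))
    {I : Submodule R K} {x : K} :
    x ∈ s I ↔ ∀ M : Ideal R, M.IsMaximal → (∃ t ∉ M, t • x ∈ I) ∨
      (M ∈ s.localizingSystem ∧ ∀ a ∈ M, ∃ t ∉ M, (t * a) • x ∈ I) := by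
  rw [hst.mem_apply_iff]
  constructor
  · intro h M hM
    by_cases hle : colonIdeal I x ≤ M
    · exact Or.inr ⟨s.localizingSystem_mono hle h, fun a ha => hs.exists_mul_mem hR hN h hM ha⟩
    · obtain ⟨t, hx, ht⟩ := SetLike.not_le_iff_exists.1 hle
      exact Or.inl ⟨t, ht, hx⟩
  · intro h
    have h' : ∀ M : Ideal R, M.IsMaximal → colonIdeal I x ≤ M → M ∈ s.localizingSystem ∧
        ∀ a ∈ M, ∃ t ∉ M, t * a ∈ colonIdeal I x := fun M hM hle =>
      (h M hM).resolve_left fun ⟨t, ht, hx⟩ => ht (hle hx)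
    -- `(I : x)` contains a finite intersection of maximal ideals of the localizing system, which is
    -- closed under finite intersections.
    obtain ⟨T, hT, hTM, hle⟩ := exists_finite_sInf_le hN fun M hM hle => (h' M hM hle).2
    exact s.localizingSystem_mono hle
      (hst.sInf_mem hT fun M hM => (h' M (hTM M hM).1 (hTM M hM).2).1)

/-- The primary ideal comes for free: a finitely generated ideal with maximal radical `P` is
`P`-primary and closed. -/
theorem IsStar.mem_pseudoSpectrum_iff {s : SemistarOperation R K} (hs : s.IsStar)
    (hR : IsPruferDomain R) (hN : TopologicalSpace.NoetherianSpace (PrimeSpectrum R))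
    {P : PrimeSpectrum R} : P ∈ s.pseudoSpectrum ↔ P.asIdeal ∈ s.localizingSystem := by
  rw [← s.closureInRing_eq_top_iff]
  refine ⟨fun h => h.1, fun h => ⟨h, ?_⟩⟩
  obtain ⟨J, hJ, hJP⟩ := exists_fg_radical_eq hN P.asIdeal P.isPrime
  have hM : P.asIdeal.IsMaximal :=
    (hs.mem_nondivisorialMax hR hN ((s.closureInRing_eq_top_iff _).1 h)).1
  refine ⟨J, Ideal.isPrimary_of_isMaximal_radical (hJP ▸ hM), hJP, ?_⟩
  rw [closureInRing, hs.apply_coeSubmodule_of_fg hR hJ]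
  exact Submodule.comap_map_eq_of_injective (IsFractionRing.injective R K) J

theorem IsStar.pseudoSpectrum_subset {s : SemistarOperation R K} (hs : s.IsStar)
    (hR : IsPruferDomain R) (hN : TopologicalSpace.NoetherianSpace (PrimeSpectrum R)) :
    s.pseudoSpectrum ⊆ nondivisorialMax R K := fun _ hP =>
  hs.mem_nondivisorialMax hR hN ((hs.mem_pseudoSpectrum_iff hR hN).1 hP)

theorem IsStar.le_iff_pseudoSpectrum_subset {s s' : SemistarOperation R K} (hs : s.IsStar)
    (hst : s.IsStable) (hs' : s'.IsStar) (hst' : s'.IsStable)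
    (hR : IsPruferDomain R) (hN : TopologicalSpace.NoetherianSpace (PrimeSpectrum R)) :
    s.pseudoSpectrum ⊆ s'.pseudoSpectrum ↔ s ≤ s' := by
  constructor
  · intro h I x hx
    rw [hs.mem_apply_iff hst hR hN] at hx
    rw [hs'.mem_apply_iff hst' hR hN]
    intro M hM
    refine (hx M hM).imp_right fun h' => ⟨?_, h'.2⟩
    exact (hs'.mem_pseudoSpectrum_iff hR hN (P := ⟨M, hM.isPrime⟩)).1
      (h ((hs.mem_pseudoSpectrum_iff hR hN).2 h'.1))
  · intro h P hP
    rw [hs.mem_pseudoSpectrum_iff hR hN] at hP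
    exact (hs'.mem_pseudoSpectrum_iff hR hN).2 (h _ hP)

theorem IsStar.apply_eq {s : SemistarOperation R K} (hs : s.IsStar) (hst : s.IsStable)
    (hR : IsPruferDomain R) (hN : TopologicalSpace.NoetherianSpace (PrimeSpectrum R))
    (I : Submodule R K) :
    s I = (⨅ P ∈ maxSpec R \ s.pseudoSpectrum, extendAt P I) ⊓
      ⨅ P ∈ s.pseudoSpectrum, vClosure (localizationIn K P) (extendAt P I) := by
  ext x
  simp only [Submodule.mem_inf, Submodule.mem_iInf]
  rw [hs.mem_apply_iff hst hR hN]
  constructor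
  · refine fun h => ⟨fun P hP => ?_, fun P hP => ?_⟩
    · exact mem_extendAt_iff_smul.2 ((h P.asIdeal hP.1).resolve_right
        fun h' => hP.2 ((hs.mem_pseudoSpectrum_iff hR hN).2 h'.1))
    · have hP' := hs.pseudoSpectrum_subset hR hN hP
      rw [mem_vClosure_extendAt_iff hR hN hP']
      intro a ha
      rcases h P.asIdeal hP'.1 with ⟨t, ht, hx⟩ | h
      · exact ⟨t, ht, by rw [mul_comm, mul_smul]; exact I.smul_mem a hx⟩
      · exact h.2 a ha
  · intro h M hM
    by_cases hP : (⟨M, hM.isPrime⟩ : PrimeSpectrum R) ∈ s.pseudoSpectrum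
    · exact Or.inr ⟨(hs.mem_pseudoSpectrum_iff hR hN).1 hP, (mem_vClosure_extendAt_iff hR hN
        (hs.pseudoSpectrum_subset hR hN hP)).1 (h.2 _ hP)⟩
    · exact Or.inl (mem_extendAt_iff_smul.1 (h.1 _ ⟨hM, hP⟩))

end SemistarOperation

/-! ### The operation attached to a set of nondivisorial maximal ideals -/

namespace SemistarOperation

variable {R K : Type*} [CommRing R] [Field K] [Algebra R K]

/-- The submodule `{x | M x ⊆ I R_M}`. -/
def divAt (P : PrimeSpectrum R) (I : Submodule R K) : Submodule R K where
  carrier := {x | ∀ a ∈ P.asIdeal, ∃ t ∉ P.asIdeal, (t * a) • x ∈ I}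
  zero_mem' := fun _ _ => ⟨1, P.isPrime.one_notMem, by simp⟩
  add_mem' := by
    intro x y hx hy a ha
    obtain ⟨t, ht, hx⟩ := hx a ha
    obtain ⟨u, hu, hy⟩ := hy a ha
    refine ⟨t * u, fun h => (P.isPrime.mem_or_mem h).elim ht hu, ?_⟩
    rw [smul_add]
    refine I.add_mem ?_ ?_
    · rw [mul_comm t, mul_assoc, mul_smul]
      exact I.smul_mem u hx
    · rw [mul_assoc, mul_smul]
      exact I.smul_mem t hy
  smul_mem' := by
    intro r x hx a ha
    obtain ⟨t, ht, hx⟩ := hx a ha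
    exact ⟨t, ht, by rw [smul_comm]; exact I.smul_mem r hx⟩

theorem mem_divAt {P : PrimeSpectrum R} {I : Submodule R K} {x : K} :
    x ∈ divAt P I ↔ ∀ a ∈ P.asIdeal, ∃ t ∉ P.asIdeal, (t * a) • x ∈ I :=
  Iff.rfl

theorem divAt_mono (P : PrimeSpectrum R) {I J : Submodule R K} (h : I ≤ J) :
    divAt P I ≤ divAt P J := fun _ hx a ha =>
  let ⟨t, ht, hx⟩ := hx a ha
  ⟨t, ht, h hx⟩

variable [IsDomain R] [IsFractionRing R K]

open Classical in
/-- The component at `P` of the stable operation attached to a set `Δ` of maximal ideals. -/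
noncomputable def component (Δ : Set (PrimeSpectrum R)) (P : PrimeSpectrum R)
    (I : Submodule R K) : Submodule R K :=
  if P ∈ Δ then divAt P I else extendAt P I

theorem mem_component_of_mem {Δ : Set (PrimeSpectrum R)} {P : PrimeSpectrum R} (hP : P ∈ Δ)
    {I : Submodule R K} {x : K} :
    x ∈ component Δ P I ↔ ∀ a ∈ P.asIdeal, ∃ t ∉ P.asIdeal, (t * a) • x ∈ I := by
  rw [component, if_pos hP, mem_divAt]

theorem mem_component_of_notMem {Δ : Set (PrimeSpectrum R)} {P : PrimeSpectrum R} (hP : P ∉ Δ)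
    {I : Submodule R K} {x : K} :
    x ∈ component Δ P I ↔ ∃ t ∉ P.asIdeal, t • x ∈ I := by
  rw [component, if_neg hP, mem_extendAt_iff_smul]

theorem component_mono (Δ : Set (PrimeSpectrum R)) (P : PrimeSpectrum R) :
    Monotone (component Δ P : Submodule R K → Submodule R K) := by
  intro I J h
  unfold component
  split_ifs
  · exact divAt_mono P h
  · exact Submodule.smul_mono_left h

theorem le_component (Δ : Set (PrimeSpectrum R)) (P : PrimeSpectrum R) (I : Submodule R K) :
    I ≤ component Δ P I := by
  intro x hx
  by_cases hP : P ∈ Δ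
  · exact (mem_component_of_mem hP).2 fun a _ =>
      ⟨1, P.isPrime.one_notMem, I.smul_mem _ hx⟩
  · exact (mem_component_of_notMem hP).2 ⟨1, P.isPrime.one_notMem, I.smul_mem _ hx⟩

theorem component_inf (Δ : Set (PrimeSpectrum R)) (P : PrimeSpectrum R) (I J : Submodule R K) :
    component Δ P (I ⊓ J) = component Δ P I ⊓ component Δ P J := by
  refine le_antisymm ((component_mono Δ P).map_inf_le I J) fun x hx => ?_
  rw [Submodule.mem_inf] at hx
  by_cases hP : P ∈ Δ
  · rw [mem_component_of_mem hP, mem_component_of_mem hP] at hx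
    refine (mem_component_of_mem hP).2 fun a ha => ?_
    obtain ⟨t, ht, hI⟩ := hx.1 a ha
    obtain ⟨u, hu, hJ⟩ := hx.2 a ha
    refine ⟨t * u, fun h => (P.isPrime.mem_or_mem h).elim ht hu, ?_, ?_⟩
    · rw [mul_comm t, mul_assoc, mul_smul]
      exact I.smul_mem u hI
    · rw [mul_assoc, mul_smul]
      exact J.smul_mem t hJ
  · rw [mem_component_of_notMem hP, mem_component_of_notMem hP] at hx
    obtain ⟨⟨t, ht, hI⟩, u, hu, hJ⟩ := hx
    refine (mem_component_of_notMem hP).2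
      ⟨t * u, fun h => (P.isPrime.mem_or_mem h).elim ht hu, ?_, ?_⟩
    · rw [mul_comm t, mul_smul]
      exact I.smul_mem u hI
    · rw [mul_smul]
      exact J.smul_mem t hJ

theorem mem_component_smul_iff (Δ : Set (PrimeSpectrum R)) (P : PrimeSpectrum R) {y : K}
    (hy : y ≠ 0) {I : Submodule R K} {x : K} :
    x ∈ component Δ P (y • I) ↔ y⁻¹ * x ∈ component Δ P I := by
  have key : ∀ r : R, r • x ∈ y • I ↔ r • (y⁻¹ * x) ∈ I := by
    intro r
    rw [Submodule.mem_smul_pointwise_iff_exists, ← mul_smul_comm]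
    constructor
    · rintro ⟨z, hz, h⟩
      rwa [← h, smul_eq_mul, inv_mul_cancel_left₀ hy]
    · exact fun h => ⟨_, h, by rw [smul_eq_mul, mul_inv_cancel_left₀ hy]⟩
  by_cases hP : P ∈ Δ
  · simp only [mem_component_of_mem hP, key]
  · simp only [mem_component_of_notMem hP, key]

/-- For `P ∈ Δ` this needs `P ≠ 0`, as `divAt` at the zero ideal is all of `K`. It serves
homogeneity for the scalar `0`. -/
theorem component_bot {Δ : Set (PrimeSpectrum R)} (hΔ : Δ ⊆ nondivisorialMax R K)
    (P : PrimeSpectrum R) : component Δ P (⊥ : Submodule R K) = ⊥ := by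
  have key : ∀ {r : R} {x : K}, r ≠ 0 → r • x ∈ (⊥ : Submodule R K) → x = 0 := by
    intro r x hr h
    rw [Submodule.mem_bot, Algebra.smul_def, mul_eq_zero,
      map_eq_zero_iff _ (IsFractionRing.injective R K)] at h
    exact h.resolve_left hr
  have h0 : ∀ t ∉ P.asIdeal, t ≠ 0 := fun t ht h => ht (h ▸ P.asIdeal.zero_mem)
  rw [eq_bot_iff]
  intro x hx
  by_cases hP : P ∈ Δ
  · obtain ⟨a, ha, ha0⟩ := Submodule.exists_mem_ne_zero_of_ne_bot
      (not_isDivisorial_ne_bot (hΔ hP).2)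
    obtain ⟨t, ht, h⟩ := (mem_component_of_mem hP).1 hx a ha
    exact key (mul_ne_zero (h0 t ht) ha0) h
  · obtain ⟨t, ht, h⟩ := (mem_component_of_notMem hP).1 hx
    exact key (h0 t ht) h

/-- This yields idempotence of the closure. For `P ∈ Δ`, any `c ∈ P` is locally `ab` with `a, b ∈
P`: multiplying by `a` moves `x` into `J` locally, and by `b` on into `I`. -/
theorem component_le_of_le_component (hR : IsPruferDomain R)
    (hN : TopologicalSpace.NoetherianSpace (PrimeSpectrum R)) {Δ : Set (PrimeSpectrum R)}
    (hΔ : Δ ⊆ nondivisorialMax R K) {P : PrimeSpectrum R} {I J : Submodule R K}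
    (h : J ≤ component Δ P I) : component Δ P J ≤ component Δ P I := by
  intro x hx
  have hmul : ∀ {t u : R}, t ∉ P.asIdeal → u ∉ P.asIdeal → t * u ∉ P.asIdeal :=
    fun ht hu h => (P.isPrime.mem_or_mem h).elim ht hu
  by_cases hP : P ∈ Δ
  · rw [mem_component_of_mem hP] at hx ⊢
    intro c hc
    obtain ⟨a, ha, b, hb, u, hu, huc⟩ :=
      hR.exists_mul_eq_mul_of_not_isDivisorial hN (hΔ hP).1 (hΔ hP).2 hc
    obtain ⟨t, ht, htx⟩ := hx a ha
    obtain ⟨w, hw, hwx⟩ := (mem_component_of_mem hP).1 (h htx) b hb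
    refine ⟨w * t * u, hmul (hmul hw ht) hu, ?_⟩
    rw [← mul_smul] at hwx
    have : w * t * u * c = w * b * (t * a) := by rw [mul_assoc, huc]; ring
    rwa [this]
  · rw [mem_component_of_notMem hP] at hx ⊢
    obtain ⟨t, ht, htx⟩ := hx
    obtain ⟨w, hw, hwx⟩ := (mem_component_of_notMem hP).1 (h htx)
    exact ⟨w * t, hmul hw ht, by rwa [mul_smul]⟩

/-- The stable operation attached to a set `Δ` of nondivisorial maximal ideals. -/
noncomputable def ofSet (hR : IsPruferDomain R)
    (hN : TopologicalSpace.NoetherianSpace (PrimeSpectrum R)) (Δ : Set (PrimeSpectrum R))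
    (hΔ : Δ ⊆ nondivisorialMax R K) : SemistarOperation R K where
  toClosureOperator := ClosureOperator.mk' (fun I => ⨅ P ∈ maxSpec R, component Δ P I)
    (fun _ _ h => iInf₂_mono fun P _ => component_mono Δ P h)
    (fun I => le_iInf₂ fun P _ => le_component Δ P I)
    (fun _ => iInf₂_mono' fun P hP => ⟨P, hP, component_le_of_le_component hR hN hΔ
      (iInf₂_le P hP)⟩)
  map_smul' := by
    intro y I
    change (⨅ P ∈ maxSpec R, component Δ P (y • I)) = y • ⨅ P ∈ maxSpec R, component Δ P I
    by_cases hy : y = 0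
    · have h0 : ∀ I : Submodule R K, (0 : K) • I = ⊥ := fun I => by
        rw [eq_bot_iff]
        intro x hx
        obtain ⟨z, -, rfl⟩ := (Submodule.mem_smul_pointwise_iff_exists _ _ _).1 hx
        simp
      obtain ⟨M, hM⟩ := Ideal.exists_maximal R
      rw [hy, h0, h0, eq_bot_iff]
      exact (iInf₂_le (⟨M, hM.isPrime⟩ : PrimeSpectrum R) hM).trans (component_bot hΔ _).le
    ext x
    rw [Submodule.mem_smul_pointwise_iff_exists]
    simp only [Submodule.mem_iInf, mem_component_smul_iff Δ _ hy]
    constructor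
    · exact fun h => ⟨y⁻¹ * x, h, by rw [smul_eq_mul, mul_inv_cancel_left₀ hy]⟩
    · rintro ⟨z, hz, rfl⟩
      rwa [smul_eq_mul, inv_mul_cancel_left₀ hy]

variable (hR : IsPruferDomain R) (hN : TopologicalSpace.NoetherianSpace (PrimeSpectrum R))
  {Δ : Set (PrimeSpectrum R)} (hΔ : Δ ⊆ nondivisorialMax R K)

theorem mem_ofSet_apply {I : Submodule R K} {x : K} :
    x ∈ ofSet hR hN Δ hΔ I ↔ ∀ P ∈ maxSpec R, x ∈ component Δ P I := by
  change x ∈ (⨅ P ∈ maxSpec R, component Δ P I) ↔ _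
  simp only [Submodule.mem_iInf]

theorem isStable_ofSet : (ofSet hR hN Δ hΔ).IsStable := by
  intro I J
  ext x
  simp only [Submodule.mem_inf, mem_ofSet_apply, component_inf]
  exact ⟨fun h => ⟨fun P hP => (h P hP).1, fun P hP => (h P hP).2⟩,
    fun h P hP => ⟨h.1 P hP, h.2 P hP⟩⟩

/-- Membership in `R` is local, and `(R_M : M R_M) = R_M` at each `M ∈ Δ`. -/
theorem isStar_ofSet : (ofSet hR hN Δ hΔ).IsStar := by
  refine le_antisymm (fun x hx => ?_) (le_apply _ _)
  rw [mem_ofSet_apply] at hx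
  have h1 : (1 : R) ∈ colonIdeal (1 : Submodule R K) x := by
    refine Ideal.mem_of_forall_isMaximal fun M hM => ?_
    simp only [mul_one, mem_colonIdeal]
    have h := hx ⟨M, hM.isPrime⟩ hM
    by_cases hP : (⟨M, hM.isPrime⟩ : PrimeSpectrum R) ∈ Δ
    · exact hR.exists_smul_mem_one_of_forall hN hM (hΔ hP).2 ((mem_component_of_mem hP).1 h)
    · exact (mem_component_of_notMem hP).1 h
  rwa [mem_colonIdeal, one_smul] at h1

/-- For `P ∈ Δ`, the component at `P` contains `1` since `P R_P ⊆ P R_P`, and at any other maximal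
`Q` since `P R_Q = R_Q`. For maximal `P ∉ Δ`, `1 ∉ P R_P`. -/
theorem pseudoSpectrum_ofSet : (ofSet hR hN Δ hΔ).pseudoSpectrum = Δ := by
  have key : ∀ {Q : Ideal R} {r : R}, r • (1 : K) ∈ IsLocalization.coeSubmodule K Q ↔ r ∈ Q := by
    intro Q r
    rw [IsLocalization.mem_coeSubmodule, Algebra.smul_def, mul_one]
    exact ⟨fun ⟨q, hq, h⟩ => IsFractionRing.injective R K h ▸ hq, fun h => ⟨r, h, rfl⟩⟩
  ext P
  rw [(isStar_ofSet hR hN hΔ).mem_pseudoSpectrum_iff hR hN]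
  constructor
  · intro h
    have h' := (mem_ofSet_apply hR hN hΔ).1 h P
      ((isStar_ofSet hR hN hΔ).mem_nondivisorialMax hR hN h).1
    by_contra hP
    obtain ⟨t, ht, h1⟩ := (mem_component_of_notMem hP).1 h'
    exact ht (key.1 h1)
  · intro hP
    refine (mem_ofSet_apply hR hN hΔ).2 fun Q hQ => ?_
    by_cases hQP : Q = P
    · subst hQP
      exact (mem_component_of_mem hP).2 fun a ha =>
        ⟨1, Q.isPrime.one_notMem, key.2 (by rwa [one_mul])⟩
    · have hnle : ¬ P.asIdeal ≤ Q.asIdeal := fun hle =>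
        hQP (PrimeSpectrum.ext ((hΔ hP).1.eq_of_le Q.isPrime.ne_top hle).symm)
      obtain ⟨t, htP, htQ⟩ := SetLike.not_le_iff_exists.1 hnle
      by_cases hQΔ : Q ∈ Δ
      · exact (mem_component_of_mem hQΔ).2 fun a ha =>
          ⟨t, htQ, key.2 (P.asIdeal.mul_mem_right a htP)⟩
      · exact (mem_component_of_notMem hQΔ).2 ⟨t, htQ, key.2 htP⟩

end SemistarOperation

/-! ### The order isomorphism and the main theorem -/

/-- The pseudo-spectrum as an isomorphism onto the power set of the nondivisorial maximal ideals. -/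
noncomputable def StableStarOperation.pseudoSpectrumIso {R K : Type*} [CommRing R] [IsDomain R]
    [Field K] [Algebra R K] [IsFractionRing R K] (hR : IsPruferDomain R)
    (hN : TopologicalSpace.NoetherianSpace (PrimeSpectrum R)) :
    StableStarOperation R K ≃o 𝒫 (nondivisorialMax R K) :=
  RelIso.ofSurjective
    (OrderEmbedding.ofMapLEIff (fun s : StableStarOperation R K =>
      (⟨s.1.pseudoSpectrum, s.2.2.pseudoSpectrum_subset hR hN⟩ : 𝒫 (nondivisorialMax R K)))
      fun s s' => s.2.2.le_iff_pseudoSpectrum_subset s.2.1 s'.2.2 s'.2.1 hR hN)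
    fun Δ => ⟨⟨SemistarOperation.ofSet hR hN Δ.1 Δ.2, SemistarOperation.isStable_ofSet hR hN Δ.2,
      SemistarOperation.isStar_ofSet hR hN Δ.2⟩,
      Subtype.ext (SemistarOperation.pseudoSpectrum_ofSet hR hN Δ.2)⟩

theorem mainTheorem3 {R : Type u} {K : Type v} [CommRing R] [IsDomain R] [Field K] [Algebra R K]
    [IsFractionRing R K] (hR : IsPruferDomain R)
    (hN : TopologicalSpace.NoetherianSpace (PrimeSpectrum R)) :
    (∀ s : SemistarOperation R K, s.IsStable → s.IsStar →
      ∃ Δ₁ Δ₂ : Set (PrimeSpectrum R),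
        Δ₁ ⊆ maxSpec R ∧ Δ₂ ⊆ maxSpec R ∧ Disjoint Δ₁ Δ₂ ∧ maxSpec R = Δ₁ ∪ Δ₂ ∧
        ∀ I : Submodule R K, s I =
          (⨅ P ∈ Δ₁, extendAt P I) ⊓ ⨅ P ∈ Δ₂, vClosure (localizationIn K P) (extendAt P I)) ∧
    (∃ Φ : StableStarOperation R K ≃o 𝒫 (nondivisorialMax R K),
      ∀ s : StableStarOperation R K, (Φ s : Set (PrimeSpectrum R)) = s.1.pseudoSpectrum) ∧
    Cardinal.lift.{u} (Cardinal.mk (StableStarOperation R K)) =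
      2 ^ Cardinal.lift.{v} (Cardinal.mk (nondivisorialMax R K)) := by
  refine ⟨fun s hst hs => ?_, ⟨StableStarOperation.pseudoSpectrumIso hR hN, fun _ => rfl⟩, ?_⟩
  · have hsub : s.pseudoSpectrum ⊆ maxSpec R := (hs.pseudoSpectrum_subset hR hN).trans
      fun _ hP => hP.1
    exact ⟨maxSpec R \ s.pseudoSpectrum, s.pseudoSpectrum, Set.sdiff_subset, hsub,
      Set.disjoint_sdiff_left, (Set.sdiff_union_of_subset hsub).symm, hs.apply_eq hst hR hN⟩
  · rw [← Cardinal.lift_two.{v, u}, ← Cardinal.lift_power, ← Cardinal.mk_powerset]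
    exact Cardinal.lift_mk_eq'.2 ⟨(StableStarOperation.pseudoSpectrumIso hR hN).toEquiv⟩
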